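/- Let $q$ be a prime power, $r\ge 1$, and let $\Omega^+(2r,q)$ be the hyperbolic polar space given by a quadratic form $Q$ with non-degenerate polar form $Q(x+y)-Q(x)-Q(y)$ on a $2r$-dimensional vector space $V$ over $\mathbb F_q$ having a totally singular subspace of dimension $r$. Its subspaces are the totally singular subspaces of $V$ (those on which $Q$ vanishes); those of dimension $r$ are called generators. For $t,k\in\{0,\dots,r\}$, a $t$-$(r,k,1)$ Steiner system in $\Omega^+(2r,q)$ is a set $D$ of $k$-dimensional totally singular subspaces such that every $t$-dimensional totally singular subspace is contained in exactly one element of $D$. There is a unique partition of the set of generators into two parts each of which is an $(r-1)$-$(r,r,1)$ Steiner system (the Latins and the Greeks, called the two Latin-Greek halvings); two generators $B,B'$ lie in the same part if and only if $r-\dim(B\cap B')$ is even. Every $(r-1)$-$(r,r,1)$ Steiner system $D$ in $\Omega^+(2r,q)$ is one of the two Latin-Greek halvings. -/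

import Mathlib

/-- A subspace `U` is totally singular for the quadratic form `Q` if `Q` vanishes on `U`.
The totally singular subspaces are the subspaces of the polar space of `Q`. -/
def IsTotallySingular {F V : Type*} [Field F] [AddCommGroup V] [Module F V]
    (Q : QuadraticForm F V) (U : Submodule F V) : Prop :=
  ∀ x ∈ U, Q x = 0

/-- `Q` defines the hyperbolic polar space `Ω⁺(2r, q)` (where `q = #F`): the ambient space has
dimension `2r`, the polar form `Q (x + y) - Q x - Q y` is nondegenerate, and there is a totally
singular subspace of dimension `r`. (Nondegeneracy bounds the dimension of totally singular
subspaces by `r`, so the rank, i.e. the Witt index, is exactly `r`.) -/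
structure IsHyperbolicForm {F V : Type*} [Field F] [AddCommGroup V] [Module F V]
    (Q : QuadraticForm F V) (r : ℕ) : Prop where
  finrank_eq : Module.finrank F V = 2 * r
  nondegenerate : ∀ x : V, (∀ y : V, QuadraticMap.polar Q x y = 0) → x = 0
  exists_generator : ∃ U : Submodule F V, IsTotallySingular Q U ∧ Module.finrank F U = r

/-- The subspaces of dimension `k` of the polar space of `Q`. -/
def polarSubspaces {F V : Type*} [Field F] [AddCommGroup V] [Module F V]
    (Q : QuadraticForm F V) (k : ℕ) : Set (Submodule F V) :=
  {U | IsTotallySingular Q U ∧ Module.finrank F U = k}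

/-- `D` is a `t-(r,k,l)` design in the polar space of `Q`, which is supposed to have rank `r`. -/
structure IsPolarDesign {F V : Type*} [Field F] [AddCommGroup V] [Module F V]
    (Q : QuadraticForm F V) (t r k l : ℕ) (D : Set (Submodule F V)) : Prop where
  strength_le : t ≤ r
  block_dim_le : k ≤ r
  subset : D ⊆ polarSubspaces Q k
  ncard_eq : ∀ T ∈ polarSubspaces Q t, {B ∈ D | T ≤ B}.ncard = l

/-- A Steiner system in a polar space is a design with `l = 1`. -/
def IsPolarSteinerSystem {F V : Type*} [Field F] [AddCommGroup V] [Module F V]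
    (Q : QuadraticForm F V) (t r k : ℕ) (D : Set (Submodule F V)) : Prop :=
  IsPolarDesign Q t r k 1 D

/-- `L`, `G` are the two legs (Latins and Greeks) of a Latin-Greek halving: they partition the set
of generators (the `r`-dimensional subspaces of the polar space) into two parts, both of which are
`(r-1)-(r,r,1)` designs, and two generators `B`, `B'` lie in the same leg if and only if
`r - dim (B ∩ B')` is even. -/
structure IsLatinGreekHalving {F V : Type*} [Field F] [AddCommGroup V] [Module F V]
    (Q : QuadraticForm F V) (r : ℕ) (L G : Set (Submodule F V)) : Prop where
  union_eq : L ∪ G = polarSubspaces Q r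
  disjoint : Disjoint L G
  left_nonempty : L.Nonempty
  right_nonempty : G.Nonempty
  left_design : IsPolarDesign Q (r - 1) r r 1 L
  right_design : IsPolarDesign Q (r - 1) r r 1 G
  same_leg_iff : ∀ B ∈ polarSubspaces Q r, ∀ B' ∈ polarSubspaces Q r,
    ((B ∈ L ↔ B' ∈ L) ↔ Even (r - Module.finrank F (B ⊓ B' : Submodule F V)))

/-!
A totally singular subspace `T` of dimension `r - 1` lies in exactly two generators: `T^⊥` has
dimension `r + 1`, and if `B`, `C` are two generators through `T`, then `T^⊥ = B ⊔ C`, so that the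
singular vectors of `T^⊥` are those in `B ∪ C`. Call two generators adjacent if they meet in
dimension `r - 1`. The argument then rests on sets of generators that *alternate*, that is, contain
exactly one of any two adjacent generators.

* `IsPolarSteinerSystem.alternating`: every `(r-1)-(r,r,1)` Steiner system alternates, and
  `IsHyperbolicForm.isPolarDesign_of_alternating` is the converse.
* `IsHyperbolicForm.alternating_even_codim`: for a fixed generator `A`, the generators `B` with
  `r - dim (A ∩ B)` even alternate. Indeed, if `T = B ∩ C` is the intersection of two adjacent
  generators, the generator `T + (A ∩ T^⊥)` is one of `B`, `C`, and `A` meets this one in one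
  dimension more than the other.
* `IsHyperbolicForm.iff_even_of_alternating`: an alternating set contains both or neither of `B`,
  `C` if and only if `r - dim (B ∩ C)` is even. Here any `C ≠ B` is replaced by an adjacent
  generator which meets `B` in one dimension more.

Hence an alternating set of generators is determined by whether it contains a fixed generator,
which leaves a single pair of complementary alternating sets.
-/

section PolarSpace

open Module Submodule

variable {F V : Type*} [Field F] [AddCommGroup V] [Module F V] {Q : QuadraticForm F V} {r : ℕ}
  {A B C T U W : Submodule F V}

/-! ### Orthogonality and totally singular subspaces -/

/-- The orthogonal complement of `U` with respect to the polar form of `Q`. -/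
def polarPerp (Q : QuadraticForm F V) (U : Submodule F V) : Submodule F V :=
  LinearMap.BilinForm.orthogonal Q.polarBilin U

theorem mem_polarPerp {x : V} :
    x ∈ polarPerp Q U ↔ ∀ u ∈ U, QuadraticMap.polar Q u x = 0 := by
  simp [polarPerp, LinearMap.BilinForm.mem_orthogonal_iff]

theorem polarPerp_anti (h : U ≤ W) : polarPerp Q W ≤ polarPerp Q U :=
  LinearMap.BilinForm.orthogonal_le h

theorem polarPerp_sup : polarPerp Q (U ⊔ W) = polarPerp Q U ⊓ polarPerp Q W := by
  refine le_antisymm (le_inf (polarPerp_anti le_sup_left) (polarPerp_anti le_sup_right)) ?_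
  rintro x ⟨hU, hW⟩
  rw [SetLike.mem_coe, mem_polarPerp] at hU hW
  rw [mem_polarPerp]
  intro y hy
  obtain ⟨u, hu, w, hw, rfl⟩ := mem_sup.1 hy
  rw [QuadraticMap.polar_add_left, hU u hu, hW w hw, add_zero]

theorem IsTotallySingular.mono (h : IsTotallySingular Q W) (hUW : U ≤ W) :
    IsTotallySingular Q U :=
  fun x hx => h x (hUW hx)

theorem IsTotallySingular.le_polarPerp (h : IsTotallySingular Q U) : U ≤ polarPerp Q U := by
  intro x hx
  rw [mem_polarPerp]
  intro u hu
  simp [QuadraticMap.polar, h _ (add_mem hu hx), h _ hu, h _ hx]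

theorem IsTotallySingular.sup (hU : IsTotallySingular Q U) (hW : IsTotallySingular Q W)
    (h : W ≤ polarPerp Q U) : IsTotallySingular Q (U ⊔ W) := by
  intro x hx
  obtain ⟨u, hu, w, hw, rfl⟩ := mem_sup.1 hx
  have := mem_polarPerp.1 (h hw) u hu
  rw [QuadraticMap.map_add Q, hU u hu, hW w hw, this, add_zero, add_zero]

theorem isTotallySingular_span_singleton {x : V} (hx : Q x = 0) :
    IsTotallySingular Q (span F {x}) := by
  intro y hy
  obtain ⟨a, rfl⟩ := mem_span_singleton.1 hy
  rw [QuadraticMap.map_smul, hx, smul_zero]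

theorem sup_span_singleton_eq_of_finrank [FiniteDimensional F V] (hTB : T ≤ B)
    (h : finrank F T + 1 = finrank F B) {b : V} (hb : b ∈ B) (hbT : b ∉ T) :
    T ⊔ span F {b} = B :=
  eq_of_le_of_finrank_le (sup_le hTB ((span_singleton_le_iff_mem _ _).2 hb))
    (by rw [finrank_sup_span_singleton hbT, h])

theorem exists_mem_notMem_of_finrank_lt [FiniteDimensional F V]
    (h : finrank F T < finrank F B) : ∃ b ∈ B, b ∉ T :=
  SetLike.not_le_iff_exists.1 fun hBT => absurd (finrank_mono hBT) (not_le.2 h)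

/-- If `U` does not contain `C`, then `C ⊓ U` is contained in a hyperplane of `C`. -/
theorem exists_le_finrank_add_one_eq [FiniteDimensional F V] (h : ¬ C ≤ U) :
    ∃ T ≤ C, C ⊓ U ≤ T ∧ finrank F T + 1 = finrank F C := by
  obtain ⟨v, hvC, hvU⟩ := SetLike.not_le_iff_exists.1 h
  obtain ⟨f, hfv, hfU⟩ := exists_le_ker_of_notMem hvU
  refine ⟨C ⊓ LinearMap.ker f, inf_le_left, inf_le_inf_left _ hfU, ?_⟩
  have hv : v ∉ C ⊓ LinearMap.ker f := fun hv => hfv hv.2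
  have hsup : C ⊓ LinearMap.ker f ⊔ span F {v} = C := by
    refine le_antisymm (sup_le inf_le_left ((span_singleton_le_iff_mem _ _).2 hvC)) fun x hx => ?_
    refine mem_sup.2 ⟨x - (f x / f v) • v, ⟨sub_mem hx (smul_mem _ _ hvC), ?_⟩,
      (f x / f v) • v, smul_mem _ _ (mem_span_singleton_self v), sub_add_cancel _ _⟩
    simp [hfv]
  rw [← finrank_sup_span_singleton hv, hsup]

/-! ### Generators through a subspace of codimension one -/

theorem finrank_inf_lt_of_ne [FiniteDimensional F V] (hB : B ∈ polarSubspaces Q r)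
    (hC : C ∈ polarSubspaces Q r) (hBC : B ≠ C) : finrank F (B ⊓ C : Submodule F V) < r := by
  rw [← hB.2]
  exact finrank_lt_finrank_of_lt (lt_of_le_of_ne inf_le_left fun h =>
    hBC (eq_of_le_of_finrank_eq (inf_eq_left.1 h) (hB.2.trans hC.2.symm)))

theorem inf_eq_of_ne [FiniteDimensional F V] (hB : B ∈ polarSubspaces Q r)
    (hC : C ∈ polarSubspaces Q r) (hBC : B ≠ C) (hTB : T ≤ B) (hTC : T ≤ C)
    (hT : finrank F T + 1 = r) : B ⊓ C = T := by
  have := finrank_inf_lt_of_ne hB hC hBC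
  exact (eq_of_le_of_finrank_le (le_inf hTB hTC) (by omega)).symm

namespace IsHyperbolicForm

variable [FiniteDimensional F V] (hQ : IsHyperbolicForm Q r)

include hQ

theorem finrank_polarPerp (U : Submodule F V) :
    finrank F (polarPerp Q U) = 2 * r - finrank F U := by
  have hnd : LinearMap.BilinForm.Nondegenerate Q.polarBilin := by
    refine ⟨fun x hx => hQ.nondegenerate x hx, fun x hx => hQ.nondegenerate x fun y => ?_⟩
    rw [QuadraticMap.polar_comm]
    exact hx y
  rw [polarPerp, LinearMap.BilinForm.finrank_orthogonal hnd, hQ.finrank_eq]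

theorem polarPerp_eq_self (hB : B ∈ polarSubspaces Q r) : polarPerp Q B = B := by
  refine (eq_of_le_of_finrank_le hB.1.le_polarPerp ?_).symm
  rw [hQ.finrank_polarPerp, hB.2]
  omega

/-- A vector orthogonal to a hyperplane `T` of a generator `B` and to one vector of `B` outside `T`
is orthogonal to `B`, hence lies in `B`. -/
theorem mem_of_polar_eq_zero (hB : B ∈ polarSubspaces Q r) (hTB : T ≤ B)
    (hT : finrank F T + 1 = r) {b w : V} (hb : b ∈ B) (hbT : b ∉ T) (hw : w ∈ polarPerp Q T)
    (hbw : QuadraticMap.polar Q b w = 0) : w ∈ B := by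
  rw [← hQ.polarPerp_eq_self hB,
    ← sup_span_singleton_eq_of_finrank hTB (hT.trans hB.2.symm) hb hbT, polarPerp_sup]
  refine ⟨hw, mem_polarPerp.2 fun u hu => ?_⟩
  obtain ⟨a, rfl⟩ := mem_span_singleton.1 hu
  rw [QuadraticMap.polar_smul_left, hbw, smul_zero]

theorem le_polarPerp_of_le (hB : B ∈ polarSubspaces Q r) (hTB : T ≤ B) : B ≤ polarPerp Q T :=
  (hQ.polarPerp_eq_self hB).ge.trans (polarPerp_anti hTB)

theorem finrank_inf_polarPerp (hA : A ∈ polarSubspaces Q r) (hT : finrank F T + 1 = r) :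
    finrank F (A ⊓ polarPerp Q T : Submodule F V) = finrank F (A ⊓ T : Submodule F V) + 1 := by
  have h1 : A ⊓ polarPerp Q T = polarPerp Q (A ⊔ T) := by
    rw [polarPerp_sup, hQ.polarPerp_eq_self hA]
  have h2 := finrank_sup_add_finrank_inf_eq A T
  have h3 := finrank_le (A ⊔ T)
  rw [hQ.finrank_eq] at h3
  have h4 := hA.2
  rw [h1, hQ.finrank_polarPerp]
  omega

/-- The generator through `T` obtained by projecting the generator `A` to `T`. -/
theorem sup_inf_polarPerp_mem (hA : A ∈ polarSubspaces Q r) (hTs : IsTotallySingular Q T)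
    (hT : finrank F T + 1 = r) : T ⊔ A ⊓ polarPerp Q T ∈ polarSubspaces Q r := by
  refine ⟨hTs.sup (hA.1.mono inf_le_left) inf_le_right, ?_⟩
  have h1 := finrank_sup_add_finrank_inf_eq T (A ⊓ polarPerp Q T)
  have h2 : T ⊓ (A ⊓ polarPerp Q T) = A ⊓ T := by
    rw [inf_left_comm, inf_eq_left.2 hTs.le_polarPerp]
  rw [h2, hQ.finrank_inf_polarPerp hA hT] at h1
  omega

/-- With `b ∈ B` outside `T` and `w ∈ T^⊥` outside `B`, the line spanned by `b` and `w` is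
hyperbolic, so it carries a singular vector which is not a multiple of `b`. -/
theorem exists_ne_generator (hB : B ∈ polarSubspaces Q r) (hTB : T ≤ B)
    (hT : finrank F T + 1 = r) : ∃ C ∈ polarSubspaces Q r, C ≠ B ∧ T ≤ C := by
  obtain ⟨b, hb, hbT⟩ : ∃ b ∈ B, b ∉ T :=
    exists_mem_notMem_of_finrank_lt (by have := hB.2; omega)
  obtain ⟨w, hw, hwB⟩ : ∃ w ∈ polarPerp Q T, w ∉ B :=
    exists_mem_notMem_of_finrank_lt (by rw [hQ.finrank_polarPerp, hB.2]; omega)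
  have hbw : QuadraticMap.polar Q b w ≠ 0 := fun h =>
    hwB (hQ.mem_of_polar_eq_zero hB hTB hT hb hbT hw h)
  set c := w - (Q w / QuadraticMap.polar Q b w) • b with hc
  have hcB : c ∉ B := fun h => hwB ((sub_mem_iff_left B (smul_mem B _ hb)).1 h)
  have hcQ : Q c = 0 := by
    rw [hc, sub_eq_add_neg, ← neg_smul, QuadraticMap.map_add Q, QuadraticMap.map_smul, hB.1 b hb,
      QuadraticMap.polar_smul_right, QuadraticMap.polar_comm Q w b, smul_zero, add_zero, smul_eq_mul,
      neg_mul, div_mul_cancel₀ _ hbw, add_neg_cancel]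
  refine ⟨T ⊔ span F {c}, ⟨(hB.1.mono hTB).sup (isTotallySingular_span_singleton hcQ) ?_, ?_⟩,
    fun h => hcB (h ▸ mem_sup_right (mem_span_singleton_self c)), le_sup_left⟩
  · rw [span_singleton_le_iff_mem]
    exact sub_mem hw (smul_mem _ _ (hQ.le_polarPerp_of_le hB hTB hb))
  · rw [finrank_sup_span_singleton fun h => hcB (hTB h), hT]

/-- There are no more than two generators through a totally singular subspace of dimension
`r - 1`: if `b + c` is singular with `b ∈ B`, `c ∈ C` and `b ∉ T`, then `c` is orthogonal to `b`
as well as to `T`, hence lies in `B`. -/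
theorem eq_or_eq_of_le (hB : B ∈ polarSubspaces Q r) (hC : C ∈ polarSubspaces Q r) (hBC : B ≠ C)
    (hTB : T ≤ B) (hTC : T ≤ C) (hT : finrank F T + 1 = r) (hA : A ∈ polarSubspaces Q r)
    (hTA : T ≤ A) : A = B ∨ A = C := by
  have hsup : B ⊔ C = polarPerp Q T := by
    refine eq_of_le_of_finrank_le
      (sup_le (hQ.le_polarPerp_of_le hB hTB) (hQ.le_polarPerp_of_le hC hTC)) ?_
    have h := finrank_sup_add_finrank_inf_eq B C
    rw [inf_eq_of_ne hB hC hBC hTB hTC hT, hB.2, hC.2] at h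
    rw [hQ.finrank_polarPerp]
    omega
  have hunion : (A : Set V) ⊆ B ∪ C := by
    intro x hx
    have hx' : x ∈ B ⊔ C := hsup ▸ hQ.le_polarPerp_of_le hA hTA hx
    obtain ⟨b, hb, c, hc, rfl⟩ := mem_sup.1 hx'
    by_cases hbT : b ∈ T
    · exact Or.inr (add_mem (hTC hbT) hc)
    · have hpol : QuadraticMap.polar Q b c = 0 := by
        rw [QuadraticMap.polar, hA.1 _ hx, hB.1 b hb, hC.1 c hc, sub_zero, sub_zero]
      exact Or.inl (add_mem hb (hQ.mem_of_polar_eq_zero hB hTB hT hb hbT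
        (hQ.le_polarPerp_of_le hC hTC hc) hpol))
  exact (AddSubgroupClass.subset_union.1 hunion).imp
    (fun h => eq_of_le_of_finrank_eq h (hA.2.trans hB.2.symm))
    (fun h => eq_of_le_of_finrank_eq h (hA.2.trans hC.2.symm))

theorem exists_two_generators (hTs : IsTotallySingular Q T) (hT : finrank F T + 1 = r) :
    ∃ B ∈ polarSubspaces Q r, ∃ C ∈ polarSubspaces Q r, B ≠ C ∧ T ≤ B ∧ T ≤ C := by
  obtain ⟨U, hU⟩ := hQ.exists_generator
  have hB := hQ.sup_inf_polarPerp_mem hU hTs hT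
  obtain ⟨C, hC, hne, hTC⟩ := hQ.exists_ne_generator hB le_sup_left hT
  exact ⟨_, hB, C, hC, hne.symm, le_sup_left, hTC⟩

/-! ### Alternating sets of generators -/

/-- Any generator `C ≠ B` is adjacent to a generator which meets `B` in one dimension more, namely
the projection of `B` to a hyperplane of `C` containing `B ⊓ C`. -/
theorem exists_adjacent_closer (hB : B ∈ polarSubspaces Q r) (hC : C ∈ polarSubspaces Q r)
    (hBC : B ≠ C) : ∃ C' ∈ polarSubspaces Q r,
      finrank F (C ⊓ C' : Submodule F V) + 1 = r ∧
      finrank F (B ⊓ C' : Submodule F V) = finrank F (B ⊓ C : Submodule F V) + 1 := by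
  have hCB : ¬ C ≤ B := fun h => hBC (eq_of_le_of_finrank_eq h (hC.2.trans hB.2.symm)).symm
  obtain ⟨T, hTC, hle, hT⟩ := exists_le_finrank_add_one_eq hCB
  rw [hC.2] at hT
  have hBT : B ⊓ T = B ⊓ C :=
    le_antisymm (inf_le_inf_left _ hTC) (le_inf inf_le_left (inf_comm B C ▸ hle))
  have hTs := hC.1.mono hTC
  have hC' := hQ.sup_inf_polarPerp_mem hB hTs hT
  set C' := T ⊔ B ⊓ polarPerp Q T with hdef
  have hTC' : T ≤ C' := le_sup_left
  have hinf : B ⊓ C' = B ⊓ polarPerp Q T :=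
    le_antisymm (inf_le_inf_left _ (hQ.le_polarPerp_of_le hC' hTC'))
      (le_inf inf_le_left le_sup_right)
  have hfin : finrank F (B ⊓ C' : Submodule F V) = finrank F (B ⊓ C : Submodule F V) + 1 := by
    rw [hinf, hQ.finrank_inf_polarPerp hB hT, hBT]
  refine ⟨C', hC', ?_, hfin⟩
  have hne : C ≠ C' := by
    intro h
    rw [← h] at hfin
    omega
  rw [inf_eq_of_ne hC hC' hne hTC hTC' hT, hT]

end IsHyperbolicForm

/-- A set of subspaces alternates if it contains exactly one of any two adjacent generators, that
is, of any two generators which meet in dimension `r - 1`. It may contain subspaces which are not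
generators, and these are irrelevant. -/
def IsAlternating (Q : QuadraticForm F V) (r : ℕ) (S : Set (Submodule F V)) : Prop :=
  ∀ B ∈ polarSubspaces Q r, ∀ C ∈ polarSubspaces Q r,
    finrank F (B ⊓ C : Submodule F V) + 1 = r → (B ∈ S ↔ C ∉ S)

theorem IsAlternating.compl {S : Set (Submodule F V)} (hS : IsAlternating Q r S) :
    IsAlternating Q r Sᶜ :=
  fun B hB C hC h => not_congr (hS B hB C hC h)

namespace IsHyperbolicForm

variable [FiniteDimensional F V] (hQ : IsHyperbolicForm Q r)

include hQ

/-- If the projection of `A` to the intersection of two adjacent generators `B`, `C` is `B`, then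
`A` meets `B` in one dimension more than `C`. -/
theorem finrank_inf_eq_add_one_of_le (hA : A ∈ polarSubspaces Q r)
    (hB : B ∈ polarSubspaces Q r) (h : finrank F (B ⊓ C : Submodule F V) + 1 = r)
    (hle : A ⊓ polarPerp Q (B ⊓ C) ≤ B) (hC : C ∈ polarSubspaces Q r) :
    finrank F (A ⊓ B : Submodule F V) = finrank F (A ⊓ C : Submodule F V) + 1 := by
  have hAB : A ⊓ B = A ⊓ polarPerp Q (B ⊓ C) :=
    le_antisymm (inf_le_inf_left _ (hQ.le_polarPerp_of_le hB inf_le_left))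
      (le_inf inf_le_left hle)
  have hAC : A ⊓ C = A ⊓ (B ⊓ C) := by
    refine le_antisymm (le_inf inf_le_left (le_inf ?_ inf_le_right))
      (inf_le_inf_left _ inf_le_right)
    exact (inf_le_inf_left _ (hQ.le_polarPerp_of_le hC inf_le_right)).trans hle
  rw [hAB, hAC, hQ.finrank_inf_polarPerp hA h]

theorem alternating_even_codim (hA : A ∈ polarSubspaces Q r) :
    IsAlternating Q r {B | Even (r - finrank F (A ⊓ B : Submodule F V))} := by
  intro B hB C hC h
  have hne : B ≠ C := by
    rintro rfl
    rw [inf_idem, hB.2] at h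
    omega
  have hP := hQ.eq_or_eq_of_le hB hC hne inf_le_left inf_le_right h
    (hQ.sup_inf_polarPerp_mem hA (hB.1.mono inf_le_left) h) le_sup_left
  have hAB : finrank F (A ⊓ B : Submodule F V) ≤ r := hA.2 ▸ finrank_mono inf_le_left
  have hAC : finrank F (A ⊓ C : Submodule F V) ≤ r := hA.2 ▸ finrank_mono inf_le_left
  rw [Set.mem_ofPred_eq, Set.mem_ofPred_eq]
  rcases hP with hP | hP
  · have h1 := hQ.finrank_inf_eq_add_one_of_le hA hB h (le_sup_right.trans hP.le) hC
    grind
  · have h1 := hQ.finrank_inf_eq_add_one_of_le hA hC (inf_comm B C ▸ h)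
      (inf_comm B C ▸ le_sup_right.trans hP.le) hB
    grind

theorem iff_even_of_alternating {S : Set (Submodule F V)} (hS : IsAlternating Q r S)
    (hB : B ∈ polarSubspaces Q r) (hC : C ∈ polarSubspaces Q r) :
    (B ∈ S ↔ C ∈ S) ↔ Even (r - finrank F (B ⊓ C : Submodule F V)) := by
  obtain ⟨d, hd⟩ : ∃ d, d = r - finrank F (B ⊓ C : Submodule F V) := ⟨_, rfl⟩
  induction d generalizing C with
  | zero =>
    have hBC : B = C := by
      by_contra hne
      have := finrank_inf_lt_of_ne hB hC hne
      omega
    rw [← hd, hBC]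
    simp
  | succ d ih =>
    have hne : B ≠ C := by
      rintro rfl
      rw [inf_idem, hB.2] at hd
      omega
    obtain ⟨C', hC', hadj, hfin⟩ := hQ.exists_adjacent_closer hB hC hne
    have h1 := ih hC' (by omega)
    have h2 := hS C hC C' hC' hadj
    have h3 : r - finrank F (B ⊓ C' : Submodule F V) = d := by omega
    rw [h3] at h1
    rw [← hd, Nat.even_add_one, ← h1, h2]
    tauto

/-! ### Alternating sets and Steiner systems -/

theorem isPolarDesign_of_alternating (hr : 1 ≤ r) {S : Set (Submodule F V)}
    (hS : IsAlternating Q r S) :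
    IsPolarDesign Q (r - 1) r r 1 (polarSubspaces Q r ∩ S) := by
  refine ⟨Nat.sub_le r 1, le_rfl, Set.inter_subset_left, fun T hT => ?_⟩
  have hdim : finrank F T + 1 = r := by rw [hT.2]; omega
  obtain ⟨B, hB, C, hC, hne, hTB, hTC⟩ := hQ.exists_two_generators hT.1 hdim
  have hBC := hS B hB C hC (by rw [inf_eq_of_ne hB hC hne hTB hTC hdim, hdim])
  have key : ∀ A, A ∈ polarSubspaces Q r → T ≤ A → A = B ∨ A = C := fun A hA hTA =>
    hQ.eq_or_eq_of_le hB hC hne hTB hTC hdim hA hTA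
  rw [Set.ncard_eq_one]
  by_cases h : B ∈ S
  · refine ⟨B, Set.eq_singleton_iff_unique_mem.2 ⟨⟨⟨hB, h⟩, hTB⟩, fun A hA => ?_⟩⟩
    exact (key A hA.1.1 hA.2).resolve_right fun hAC => hBC.1 h (hAC ▸ hA.1.2)
  · refine ⟨C, Set.eq_singleton_iff_unique_mem.2 ⟨⟨⟨hC, ?_⟩, hTC⟩, fun A hA => ?_⟩⟩
    · exact not_not.1 fun hCS => h (hBC.2 hCS)
    · exact (key A hA.1.1 hA.2).resolve_left fun hAB => h (hAB ▸ hA.1.2)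

end IsHyperbolicForm

theorem IsPolarSteinerSystem.alternating [FiniteDimensional F V] (hQ : IsHyperbolicForm Q r)
    {D : Set (Submodule F V)} (hD : IsPolarSteinerSystem Q (r - 1) r r D) :
    IsAlternating Q r D := by
  intro B hB C hC h
  obtain ⟨A, hA⟩ := Set.ncard_eq_one.1
    (hD.ncard_eq (B ⊓ C) ⟨hB.1.mono inf_le_left, by omega⟩)
  have hne : B ≠ C := by
    rintro rfl
    rw [inf_idem, hB.2] at h
    omega
  have hmem : A ∈ {E ∈ D | B ⊓ C ≤ E} := hA ▸ Set.mem_singleton A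
  have huniq : ∀ E ∈ D, B ⊓ C ≤ E → E = A := fun E hE hle =>
    Set.mem_singleton_iff.1 (hA ▸ (⟨hE, hle⟩ : E ∈ {E ∈ D | B ⊓ C ≤ E}))
  constructor
  · exact fun hBD hCD => hne ((huniq B hBD inf_le_left).trans (huniq C hCD inf_le_right).symm)
  · intro hCD
    rcases hQ.eq_or_eq_of_le hB hC hne inf_le_left inf_le_right h (hD.subset hmem.1) hmem.2
      with rfl | rfl
    · exact hmem.1
    · exact absurd hmem.1 hCD

end PolarSpace

theorem mainTheorem8 {F V : Type*} [Field F] [Finite F] [AddCommGroup V] [Module F V]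
    (r : ℕ) (hr : 1 ≤ r) (Q : QuadraticForm F V) (hQ : IsHyperbolicForm Q r) :
    ∃ L G : Set (Submodule F V),
      IsLatinGreekHalving Q r L G ∧
      (∀ L' G' : Set (Submodule F V),
        L' ∪ G' = polarSubspaces Q r → Disjoint L' G' →
        IsPolarDesign Q (r - 1) r r 1 L' → IsPolarDesign Q (r - 1) r r 1 G' →
        (L' = L ∧ G' = G) ∨ (L' = G ∧ G' = L)) ∧
      ∀ D : Set (Submodule F V),
        IsPolarSteinerSystem Q (r - 1) r r D → D = L ∨ D = G := by
  have : FiniteDimensional F V :=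
    Module.finite_of_finrank_pos (by rw [hQ.finrank_eq]; omega)
  obtain ⟨A, hA⟩ : ∃ A, A ∈ polarSubspaces Q r := hQ.exists_generator
  set S : Set (Submodule F V) :=
    {B | Even (r - Module.finrank F (A ⊓ B : Submodule F V))} with hSdef
  have hS : IsAlternating Q r S := hQ.alternating_even_codim hA
  have hAS : A ∈ S := by
    rw [hSdef, Set.mem_ofPred_eq, inf_idem, hA.2, Nat.sub_self]
    exact Even.zero
  have hclass : ∀ D : Set (Submodule F V), IsPolarSteinerSystem Q (r - 1) r r D →
      D = polarSubspaces Q r ∩ S ∨ D = polarSubspaces Q r ∩ Sᶜ := by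
    intro D hD
    have hiff : ∀ B ∈ polarSubspaces Q r, (A ∈ D ↔ B ∈ D) ↔ B ∈ S := fun B hB =>
      hQ.iff_even_of_alternating (hD.alternating hQ) hA hB
    by_cases hAD : A ∈ D
    · refine Or.inl (Set.ext fun B => ⟨fun hB => ⟨hD.subset hB, ?_⟩, fun hB => ?_⟩)
      · exact (hiff B (hD.subset hB)).1 (iff_of_true hAD hB)
      · exact ((hiff B hB.1).2 hB.2).1 hAD
    · refine Or.inr (Set.ext fun B => ⟨fun hB => ⟨hD.subset hB, fun hBS => ?_⟩, fun hB => ?_⟩)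
      · exact hAD (((hiff B (hD.subset hB)).2 hBS).2 hB)
      · exact by_contra fun hBD => hB.2 ((hiff B hB.1).1 (iff_of_false hAD hBD))
  refine ⟨polarSubspaces Q r ∩ S, polarSubspaces Q r ∩ Sᶜ, ?_, ?_, hclass⟩
  · refine ⟨Set.inter_union_compl _ _, ?_, ⟨A, hA, hAS⟩, ?_,
      hQ.isPolarDesign_of_alternating hr hS, hQ.isPolarDesign_of_alternating hr hS.compl, ?_⟩
    · exact (disjoint_compl_right (a := S)).mono Set.inter_subset_right Set.inter_subset_right
    · -- Any hyperplane `T` of `A` lies in a second generator, which is adjacent to `A`.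
      have hA0 : ¬ A ≤ ⊥ := fun h => by
        have := hA.2
        rw [le_bot_iff.1 h, finrank_bot] at this
        omega
      obtain ⟨T, hTA, -, hT⟩ := exists_le_finrank_add_one_eq hA0
      rw [hA.2] at hT
      obtain ⟨C, hC, hne, hTC⟩ := hQ.exists_ne_generator hA hTA hT
      have hadj := inf_eq_of_ne hA hC hne.symm hTA hTC hT
      exact ⟨C, hC, (hS A hA C hC (by rw [hadj, hT])).1 hAS⟩
    · intro B hB C hC
      rw [← hQ.iff_even_of_alternating hS hB hC]
      simp [hB, hC]
  · intro L' G' hunion hdisj hL _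
    have hG : G' = polarSubspaces Q r \ L' := by
      rw [← hunion, Set.union_sdiff_left, hdisj.symm.sdiff_eq_left]
    refine (hclass L' hL).imp (fun h => ⟨h, ?_⟩) (fun h => ⟨h, ?_⟩)
    · rw [hG, h, Set.sdiff_self_inter, Set.sdiff_eq]
    · rw [hG, h, Set.sdiff_self_inter, Set.sdiff_eq, compl_compl]
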